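/- Let $k\ge 0$. A network with $k$ edge types is a finite set of cells $C$ with maps $\sigma_1,\dots,\sigma_k:C\to C$ ($\sigma_i(c)$ is the source of the unique edge of type $i$ into $c$); networks are considered up to relabelling of cells. It is a feed-forward network with layers $C_0,\dots,C_m$ if it is connected, the nonempty sets $C_0,\dots,C_m$ partition $C$, $\sigma_i(c)=c$ for all $i$ and $c\in C_0$, $\sigma_i(C_j)\subseteq C_{j-1}$ for all $i$ and $1\le j\le m$, and every cell of $C_j$, $j<m$, equals $\sigma_i(c')$ for some $i$ and some $c'\in C_{j+1}$. An equivalence relation $\bowtie$ on the cells is balanced if $c\bowtie c'$ implies $\sigma_i(c)\bowtie\sigma_i(c')$ for all $i$; it defines a quotient network on the classes, and $L$ is a lift of $N$ if $N=L/{\bowtie}$ for some balanced $\bowtie$. A feed-forward lift $L$ of $N$, with layers $C'_0,\dots,C'_n$, is a lift inside the layer $C_j$ of $N$ if $n=m$, $|C'_j|\ne|C_j|$ and $|C'_i|=|C_i|$ for all $i\neq j$. Let $\mathcal V$ be the set of smooth $f:\mathbb R\times\mathbb R^k\times\mathbb R\to\mathbb R$, $(x_0,(x_1,\dots,x_k),\lambda)\mapsto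 f$, with $f(0,0,\lambda)=0$ for all $\lambda$, with the $C^\infty$ topology (uniform convergence of all derivatives on compact sets), and let $\mathcal V_0=\{f\in\mathcal V:\ \partial f/\partial x_0(0,0,0)=0\}$. A property holds for generic $f\in\mathcal V_0$ if it holds on an open dense subset of $\mathcal V_0$. For a network $L$ put $f^L(x,\lambda)_c=f(x_c,(x_{\sigma_1(c)},\dots,x_{\sigma_k(c)}),\lambda)$. An equilibrium branch of $f$ on $L$ is a function $b:D\to\mathbb R^{|L|}$ with $b(0)=0$ and $f^L(b(\lambda),\lambda)=0$ for all $\lambda\in D$, where, for some $r>0$, either $D=]-r,r[$ and $b$ is smooth, or $D$ is $[0,r[$ or $]-r,0]$ and $b(\lambda)$ is a smooth function of $|\lambda|^{2^{-p}}\in[0,r^{2^{-p}}[$ for some integer $p\ge0$. It is a bifurcation branch if its germ at $0$ is not that of the zero function. It is lifted from $N$ if there is a balanced $\bowtie$ on $L$ with $L/{\bowtie}=N$ such that, for all $\lambda\in D$ near $0$, $b_c(\lambda)=b_d(\lambda)$ whenever $c\bowtie d$. **Proposition.** For generic $f\in\mathcal V_0$ the following holds. Let $N$ be a feed-forward network with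 $k$ edge types and layers $C_0,\dots,C_m$, let $0<j<m$ with $|C_{j+1}|=1$, and let $L$ be a feed-forward lift of $N$ which is a lift inside the layer $C_j$. Then there is a bifurcation branch of $f$ on $L$ that is not lifted from $N$. -/

import Mathlib

open Set Filter Topology
open scoped ContDiff

namespace FFN

/-! ### Networks, balanced colorings, quotients and lifts -/

/-- A network with `k` edge types on the set of cells `C`: every cell `c` is the target of exactly
one edge of each type `i`, whose source is `σ i c`. -/
structure Network (k : ℕ) (C : Type*) where
  σ : Fin k → C → C

variable {k : ℕ} {C C' : Type*}

/-- Equality of networks up to a relabelling of the cells. -/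
def Network.Same (N : Network k C) (N' : Network k C') : Prop :=
  ∃ φ : C ≃ C', ∀ (i : Fin k) (c : C), φ (N.σ i c) = N'.σ i (φ c)

/-- A coloring (an equivalence relation on the cells) is balanced if cells of the same color have,
for each edge type, inputs of the same color. -/
def Network.Balanced (L : Network k C) (s : Setoid C) : Prop :=
  ∀ (i : Fin k) (c c' : C), s c c' → s (L.σ i c) (L.σ i c')

/-- The quotient network associated to a balanced coloring. -/
def Network.quotient (L : Network k C) (s : Setoid C) (h : L.Balanced s) :
    Network k (Quotient s) where
  σ i := Quotient.map (L.σ i) (fun c c' hc => h i c c' hc)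

/-- `L` is a lift of `N`: `N` is the quotient of `L` by some balanced coloring. -/
def IsLift (L : Network k C') (N : Network k C) : Prop :=
  ∃ (s : Setoid C') (h : L.Balanced s), (L.quotient s h).Same N

/-! ### Feed-forward networks -/

/-- `N` is a (connected) feed-forward network with layers `C_0, …, C_m`, where
`C_j = {c | layer c = j}` for `0 ≤ j ≤ m`. -/
structure IsFeedForward (N : Network k C) (m : ℕ) (layer : C → ℕ) : Prop where
  layer_le : ∀ c, layer c ≤ m
  layer_nonempty : ∀ j ≤ m, ∃ c, layer c = j
  first_layer : ∀ c, layer c = 0 → ∀ i, N.σ i c = c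
  next_layer : ∀ c j, layer c = j + 1 → ∀ i, layer (N.σ i c) = j
  source : ∀ c, layer c < m → ∃ c' i, layer c' = layer c + 1 ∧ c = N.σ i c'
  connected : ∀ c c', Relation.EqvGen (fun a a' => ∃ i, N.σ i a' = a) c c'

/-- The number of cells `|C_j|` of the `j`-th layer. -/
noncomputable def layerCard (layer : C → ℕ) (j : ℕ) : ℕ := {c | layer c = j}.ncard

/-- The feed-forward network `L` (layers `C'_0, …, C'_n`) is a lift of the feed-forward network
`N` (layers `C_0, …, C_m`) inside the layer `C_j`. -/
structure IsLiftInsideLayer (N : Network k C) (m : ℕ) (layer : C → ℕ)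
    (L : Network k C') (n : ℕ) (layer' : C' → ℕ) (j : ℕ) : Prop where
  lift : IsLift L N
  le : j ≤ m
  same_length : m = n
  card_ne : layerCard layer' j ≠ layerCard layer j
  card_eq : ∀ i ≤ m, i ≠ j → layerCard layer' i = layerCard layer i

/-! ### Families of admissible vector fields -/

/-- The set `𝒱` of smooth functions `f : ℝ × ℝ^k × ℝ → ℝ`, `(x₀, (x₁, …, x_k), l) ↦ f`, with
`f (0, 0, l) = 0` for all values `l` of the parameter. -/
structure Family (k : ℕ) where
  toFun : ℝ × (Fin k → ℝ) × ℝ → ℝ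
  smooth : ContDiff ℝ ∞ toFun
  map_zero : ∀ l : ℝ, toFun (0, 0, l) = 0

/-- The `n`-th derivative of a member of `𝒱`, as a continuous map. -/
noncomputable def Family.deriv (n : ℕ) (f : Family k) :
    C(ℝ × (Fin k → ℝ) × ℝ, ContinuousMultilinearMap ℝ (fun _ : Fin n => ℝ × (Fin k → ℝ) × ℝ) ℝ) where
  toFun := iteratedFDeriv ℝ n f.toFun
  continuous_toFun := f.smooth.continuous_iteratedFDeriv (by exact_mod_cast le_top)

/-- The `C^∞` topology: uniform convergence of all derivatives on compact sets. -/
noncomputable instance : TopologicalSpace (Family k) :=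
  ⨅ n : ℕ, TopologicalSpace.induced (Family.deriv n) inferInstance

/-- `𝒱₀`: the members of `𝒱` with `f₀ = ∂f/∂x₀ (0) = 0` (a bifurcation condition associated with
the internal dynamics). -/
def V0 (k : ℕ) : Set (Family k) :=
  {f | _root_.deriv (fun x : ℝ => f.toFun (x, 0, 0)) 0 = 0}

/-- The property `P` holds for generic `f ∈ 𝒱₀`: it holds on an open and dense subset of `𝒱₀`. -/
def GenericInV0 (k : ℕ) (P : Family k → Prop) : Prop :=
  ∃ G : Set (V0 k), IsOpen G ∧ Dense G ∧ ∀ f ∈ G, P f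

/-- The admissible vector field `f^N (·, l)` of the network `N` defined by `f`. -/
def Network.field (N : Network k C) (f : Family k) (x : C → ℝ) (l : ℝ) : C → ℝ :=
  fun c => f.toFun (x c, fun i => x (N.σ i c), l)

/-! ### Branches -/

/-- `b` is a smooth function of `|l|^(2^(-p))`, for some `p`, on the one-sided domain
`{e * u | 0 ≤ u < r}`, where `e = 1` or `e = -1`. -/
def RootSmooth (e r : ℝ) (b : ℝ → C → ℝ) : Prop :=
  ∃ p : ℕ, ∀ c, ContDiffOn ℝ ∞ (fun t : ℝ => b (e * t ^ (2 ^ p)) c) {t | 0 ≤ t ∧ t ^ (2 ^ p) < r}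

/-- `D` is one of the domains `]-r, r[`, `[0, r[`, `]-r, 0]`, and `b` is regular on `D`: smooth in
the two-sided case, smooth in a root `|l|^(2^(-p))` in the one-sided cases. -/
def RegularOn (D : Set ℝ) (b : ℝ → C → ℝ) : Prop :=
  ∃ r : ℝ, 0 < r ∧
    ((D = Ioo (-r) r ∧ ∀ c, ContDiffOn ℝ ∞ (fun l => b l c) D) ∨
      (D = Ico 0 r ∧ RootSmooth 1 r b) ∨
      (D = Ioc (-r) 0 ∧ RootSmooth (-1) r b))

/-- `b : D → ℝ^|N|` represents an equilibrium branch of `f` on `N` at the origin. -/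
structure IsEquilibriumBranch (N : Network k C) (f : Family k) (D : Set ℝ) (b : ℝ → C → ℝ) :
    Prop where
  regular : RegularOn D b
  origin : b 0 = 0
  equilibrium : ∀ l ∈ D, N.field f (b l) l = 0

/-- A bifurcation branch is an equilibrium branch whose germ at `0` differs from that of the
trivial branch. -/
def IsBifurcationBranch (N : Network k C) (f : Family k) (D : Set ℝ) (b : ℝ → C → ℝ) : Prop :=
  IsEquilibriumBranch N f D b ∧ ¬ ∀ᶠ l in 𝓝[D] 0, b l = 0

/-- The polydiagonal subspace associated to a coloring. -/
def polydiagonal (s : Setoid C) : Set (C → ℝ) := {x | ∀ c d, s c d → x c = x d}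

/-- The (germ of the) branch `b` on `L` is lifted from `N`: it lies in the polydiagonal subspace
of some balanced coloring whose quotient network is `N`. -/
def IsLiftedFrom (L : Network k C') (N : Network k C) (D : Set ℝ) (b : ℝ → C' → ℝ) : Prop :=
  ∃ (s : Setoid C') (h : L.Balanced s),
    (∀ᶠ l in 𝓝[D] 0, b l ∈ polydiagonal s) ∧ (L.quotient s h).Same N

end FFN

namespace FFN

/-! ### Smooth dependence of integrals on parameters, and division by a variable -/

/-! Let `d` be the only cell of layer `j + 1` of `L`. Every quotient map onto `N` sends `d` to the
only cell of layer `j + 1` of `N`, and every cell of layer `j` is an input of `d`; so all quotient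
maps agree on layer `j`. They map it onto `C_j`, and not injectively since the cardinalities differ.
Hence two cells `a ≠ a'` of layer `j` are identified by every balanced coloring with quotient `N`
(`exists_pair_of_isLiftInsideLayer`), and any branch separating `a` from `a'` is nonzero and not
lifted.

Such a branch is built layer by layer. Up to layer `j` all cells are zero except `a'`, which follows
the nontrivial transcritical branch of `f (x, 0, l) = 0`, of order `l`. The cell `d` then satisfies
a fold equation whose leading input term comes from the edges out of `a'`; it has a root of order
`|l|^(1/2)` on one side of `l = 0` (`exists_isPartialBranch_base`). In each later layer all cells
take a common value and solve a fold equation driven by the previous layer, which halves the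
exponent (`IsPartialBranch.step`). At each fold the sign of the root is chosen so that the next fold
is solvable.

Each equation is solved by blowing up `f` with suitable weights (`Family.exists_rescaling`) and
applying the implicit function theorem (`Family.exists_root`). Only finitely many Taylor
coefficients, depending on `k` alone, must not vanish, so a single open dense set serves all
networks. -/

theorem hasFDerivAt_integral_of_contDiff {E F : Type*} [NormedAddCommGroup E] [NormedSpace ℝ E]
    [ProperSpace E] [NormedAddCommGroup F] [NormedSpace ℝ F]
    {g : E × ℝ → F} (hg : ContDiff ℝ 1 g) (x : E) :
    HasFDerivAt (fun e => ∫ t in (0 : ℝ)..1, g (e, t))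
      (∫ t in (0 : ℝ)..1, (fderiv ℝ g (x, t)).comp (ContinuousLinearMap.inl ℝ E ℝ)) x := by
  have hd : Continuous (fun p : E × ℝ => (fderiv ℝ g p).comp (ContinuousLinearMap.inl ℝ E ℝ)) :=
    (hg.continuous_fderiv one_ne_zero).clm_comp continuous_const
  obtain ⟨B, hB⟩ := ((isCompact_closedBall x 1).prod (isCompact_Icc (a := (0 : ℝ)) (b := 1))
    ).exists_bound_of_continuousOn hd.continuousOn
  refine intervalIntegral.hasFDerivAt_integral_of_dominated_of_fderiv_le (bound := fun _ => B)
    (F' := fun e t => (fderiv ℝ g (e, t)).comp (ContinuousLinearMap.inl ℝ E ℝ))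
    (Metric.closedBall_mem_nhds x one_pos) ?_ ?_ ?_ ?_ ?_ ?_
  · refine Eventually.of_forall fun e => ?_
    exact (hg.continuous.comp (by fun_prop : Continuous fun t : ℝ => (e, t))).aestronglyMeasurable
  · exact (hg.continuous.comp (by fun_prop : Continuous fun t : ℝ => (x, t))).intervalIntegrable _ _
  · exact (hd.comp (by fun_prop : Continuous fun t : ℝ => (x, t))).aestronglyMeasurable
  · refine Eventually.of_forall fun t ht e he => hB (e, t) ⟨he, ?_⟩
    rw [uIoc_of_le zero_le_one] at ht
    exact ⟨ht.1.le, ht.2⟩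
  · exact intervalIntegrable_const
  · refine Eventually.of_forall fun t _ e _ => ?_
    exact ((hg.differentiable one_ne_zero) (e, t)).hasFDerivAt.comp e (hasFDerivAt_prodMk_left e t)

/-- Induction on the order of differentiability. The target `F` varies in the induction because the
derivative is an integral of the same kind with values in `E →L[ℝ] F`. -/
theorem contDiff_integral_of_contDiff {E : Type} [NormedAddCommGroup E] [NormedSpace ℝ E]
    [ProperSpace E] (n : ℕ) : ∀ {F : Type} [NormedAddCommGroup F] [NormedSpace ℝ F]
    {g : E × ℝ → F}, ContDiff ℝ n g → ContDiff ℝ n (fun e => ∫ t in (0 : ℝ)..1, g (e, t)) := by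
  induction n with
  | zero =>
    intro F _ _ g hg
    rw [Nat.cast_zero, contDiff_zero] at *
    exact intervalIntegral.continuous_parametric_intervalIntegral_of_continuous' (by fun_prop) _ _
  | succ n ih =>
    intro F _ _ g hg
    rw [Nat.cast_succ] at *
    refine contDiff_succ_iff_hasFDerivAt.2 ⟨_, ?_,
      hasFDerivAt_integral_of_contDiff (hg.of_le (by simp))⟩
    exact ih (g := fun p => (fderiv ℝ g p).comp (ContinuousLinearMap.inl ℝ E ℝ))
      ((hg.fderiv_right le_rfl).clm_comp contDiff_const)

/-- Hadamard's lemma: the quotient is `∫₀¹ ∂ₛG (t s, y) dt`. -/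
theorem exists_contDiff_eq_mul {E : Type} [NormedAddCommGroup E] [NormedSpace ℝ E]
    [ProperSpace E] {G : ℝ × E → ℝ} (hG : ContDiff ℝ ∞ G) (h0 : ∀ y, G (0, y) = 0) :
    ∃ H : ℝ × E → ℝ, ContDiff ℝ ∞ H ∧ ∀ s y, G (s, y) = s * H (s, y) := by
  have hd : ContDiff ℝ ∞ (fderiv ℝ G) := hG.fderiv_right (by simp)
  have hg : ContDiff ℝ ∞
      (fun q : (ℝ × E) × ℝ => fderiv ℝ G (q.2 * q.1.1, q.1.2) ((1 : ℝ), (0 : E))) := by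
    fun_prop
  refine ⟨fun p => ∫ t in (0 : ℝ)..1, fderiv ℝ G (t * p.1, p.2) (1, 0), ?_, fun s y => ?_⟩
  · exact contDiff_infty.2 fun n => contDiff_integral_of_contDiff n (contDiff_infty.1 hg n)
  · have hderiv : ∀ t ∈ uIcc (0 : ℝ) 1, HasDerivAt (fun t : ℝ => G (t * s, y))
        (s * fderiv ℝ G (t * s, y) (1, 0)) t := by
      intro t _
      have h1 : HasDerivAt (fun t : ℝ => (t * s, y)) (s, (0 : E)) t := by
        simpa using ((hasDerivAt_id t).mul_const s).prodMk (hasDerivAt_const t y)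
      have h2 := ((hG.differentiable (by simp)) (t * s, y)).hasFDerivAt.comp_hasDerivAt t h1
      have h3 : ((s : ℝ), (0 : E)) = s • ((1 : ℝ), (0 : E)) := by simp
      rwa [h3, map_smul, smul_eq_mul] at h2
    have hc : Continuous fun t : ℝ => s * fderiv ℝ G (t * s, y) (1, 0) :=
      continuous_const.mul
        (hg.continuous.comp (by fun_prop : Continuous fun t : ℝ => (((s, y) : ℝ × E), t)))
    have := intervalIntegral.integral_eq_sub_of_hasDerivAt hderiv (hc.intervalIntegrable _ _)
    rw [intervalIntegral.integral_const_mul] at this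
    simpa [h0] using this.symm

/-! ### The implicit function theorem with a smooth solution in a neighbourhood -/

/-- The linear equivalence `(q, z) ↦ (q, l (q, z))`, for `l` with `l (0, 1) ≠ 0`. -/
noncomputable def graphEquiv {P : Type*} [NormedAddCommGroup P] [NormedSpace ℝ P]
    (l : P × ℝ →L[ℝ] ℝ) (hl : l (0, 1) ≠ 0) : (P × ℝ) ≃L[ℝ] (P × ℝ) :=
  ContinuousLinearEquiv.equivOfInverse ((ContinuousLinearMap.fst ℝ P ℝ).prod l)
    ((ContinuousLinearMap.fst ℝ P ℝ).prod ((l (0, 1))⁻¹ • (ContinuousLinearMap.snd ℝ P ℝ -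
      l.comp ((ContinuousLinearMap.inl ℝ P ℝ).comp (ContinuousLinearMap.fst ℝ P ℝ)))))
    (fun ⟨q, z⟩ => by
      have h : l (q, z) = l (q, 0) + z * l (0, 1) := by
        rw [← smul_eq_mul, ← map_smul, ← map_add]; simp
      ext
      · simp
      · simp only [ContinuousLinearMap.prod_apply, ContinuousLinearMap.coe_fst',
          smul_apply, sub_apply,
          ContinuousLinearMap.coe_snd', ContinuousLinearMap.comp_apply,
          ContinuousLinearMap.inl_apply, smul_eq_mul, h]
        field_simp
        ring)
    (fun ⟨q, z⟩ => by
      have h : ∀ u : ℝ, l (q, u) = l (q, 0) + u * l (0, 1) := fun u => by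
        rw [← smul_eq_mul, ← map_smul, ← map_add]; simp
      ext
      · simp
      · simp only [ContinuousLinearMap.prod_apply, ContinuousLinearMap.coe_fst',
          smul_apply, sub_apply,
          ContinuousLinearMap.coe_snd', ContinuousLinearMap.comp_apply,
          ContinuousLinearMap.inl_apply, smul_eq_mul]
        rw [h]
        field_simp
        ring)

/-- The inverse function theorem for `(q, z) ↦ (q, Φ (q, z))`. The partial derivative stays nonzero
near the base point, so the local inverse is smooth at every nearby point; smoothness of order `∞`
at `q₀` alone would not give a common neighbourhood for all orders. -/
theorem exists_smooth_implicit {P : Type*} [NormedAddCommGroup P] [NormedSpace ℝ P]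
    [CompleteSpace P] {Φ : P × ℝ → ℝ} (hΦ : ContDiff ℝ ∞ Φ) {q₀ : P} {z₀ : ℝ}
    (h0 : Φ (q₀, z₀) = 0) (h1 : fderiv ℝ Φ (q₀, z₀) (0, 1) ≠ 0) :
    ∃ ζ : P → ℝ, ζ q₀ = z₀ ∧ ∀ᶠ q in 𝓝 q₀, Φ (q, ζ q) = 0 ∧ ContDiffAt ℝ ∞ ζ q := by
  set Θ : P × ℝ → P × ℝ := fun u => (u.1, Φ u) with hΘ
  have hΘs : ContDiff ℝ ∞ Θ := contDiff_fst.prodMk hΦ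
  have hD : ∀ u (hu : fderiv ℝ Φ u (0, 1) ≠ 0),
      HasFDerivAt Θ (graphEquiv (fderiv ℝ Φ u) hu : (P × ℝ) →L[ℝ] (P × ℝ)) u := fun u hu =>
    hasFDerivAt_fst.prodMk ((hΦ.differentiable (by simp)) u).hasFDerivAt
  set e := hΘs.contDiffAt.toOpenPartialHomeomorph Θ (hD _ h1) (by simp) with he
  have hsrc : (q₀, z₀) ∈ e.source := ContDiffAt.mem_toOpenPartialHomeomorph_source _ _ _
  have hecoe : ∀ u, e u = (u.1, Φ u) := fun u => rfl
  have he0 : e (q₀, z₀) = (q₀, 0) := by rw [hecoe, h0]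
  have hsymm0 : e.symm (q₀, 0) = (q₀, z₀) := by rw [← he0, e.left_inv hsrc]
  have htgt : (q₀, (0 : ℝ)) ∈ e.target := he0 ▸ e.map_source hsrc
  have hcont : ContinuousAt e.symm (q₀, 0) := e.continuousAt_symm htgt
  have hι : Tendsto (fun q : P => (q, (0 : ℝ))) (𝓝 q₀) (𝓝 (q₀, 0)) :=
    Continuous.tendsto (by fun_prop) q₀
  have hopen : ∀ᶠ u in 𝓝 (q₀, z₀), fderiv ℝ Φ u (0, 1) ≠ 0 := by
    have : Continuous fun u => fderiv ℝ Φ u (0, 1) :=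
      (hΦ.continuous_fderiv (by simp)).clm_apply continuous_const
    exact this.continuousAt.eventually_ne h1
  have hne : ∀ᶠ q in 𝓝 q₀, fderiv ℝ Φ (e.symm (q, 0)) (0, 1) ≠ 0 := by
    rw [← hsymm0] at hopen
    exact hι.eventually (hcont.eventually hopen)
  refine ⟨fun q => (e.symm (q, 0)).2, by simp [hsymm0], ?_⟩
  filter_upwards [hne, hι.eventually (e.open_target.mem_nhds htgt)] with q hq hqt
  have hr := e.right_inv hqt
  rw [hecoe, Prod.mk.injEq] at hr
  refine ⟨?_, ?_⟩
  · rw [show (q, (e.symm (q, 0)).2) = e.symm (q, 0) from Prod.ext hr.1.symm rfl]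
    exact hr.2
  · have := e.contDiffAt_symm hqt (hD _ hq) hΘs.contDiffAt
    exact contDiffAt_snd.comp q (this.comp q (by fun_prop))

variable {k : ℕ} {C C' : Type*}

/-! ### The Taylor coefficients of a family -/

/-- The coefficient `∂²f/∂x₀²` at the origin. -/
noncomputable def Family.coeffXX (f : Family k) : ℝ :=
  fderiv ℝ (fderiv ℝ f.toFun) 0 (1, 0, 0) (1, 0, 0)

/-- The coefficient `∂²f/∂x₀∂l` at the origin. -/
noncomputable def Family.coeffXL (f : Family k) : ℝ :=
  fderiv ℝ (fderiv ℝ f.toFun) 0 (1, 0, 0) (0, 0, 1)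

/-- The directional derivative of `f` at the origin, in the direction `v` of the inputs. -/
noncomputable def Family.inputDeriv (f : Family k) (v : Fin k → ℝ) : ℝ :=
  fderiv ℝ f.toFun 0 (0, v, 0)

/-- The nondegeneracy conditions: `∂²f/∂x₀²` and `∂²f/∂x₀∂l` do not vanish at the origin, and the
sum of the `∂f/∂x_i` over any nonempty set of indices does not vanish at the origin. -/
structure Family.Nondegenerate (f : Family k) : Prop where
  coeffXX_ne : f.coeffXX ≠ 0
  coeffXL_ne : f.coeffXL ≠ 0
  inputDeriv_ne : ∀ A : Finset (Fin k), A.Nonempty → f.inputDeriv (fun i => if i ∈ A then 1 else 0) ≠ 0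

theorem Family.fderiv_x_eq_zero {f : Family k} (hf : f ∈ V0 k) :
    fderiv ℝ f.toFun 0 (1, 0, 0) = 0 := by
  have h1 : HasDerivAt (fun x : ℝ => ((x, 0, 0) : ℝ × (Fin k → ℝ) × ℝ)) (1, 0, 0) 0 :=
    (hasDerivAt_id (0 : ℝ)).prodMk (hasDerivAt_const (0 : ℝ) ((0, 0) : (Fin k → ℝ) × ℝ))
  have h2 := ((f.smooth.differentiable (by simp)) (0, 0, 0)).hasFDerivAt.comp_hasDerivAt 0 h1
  have h3 : _root_.deriv (fun x : ℝ => f.toFun (x, 0, 0)) 0 = 0 := hf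
  exact h2.deriv.symm.trans h3

/-- The weights 1, 2, 1 of `x₀`, the inputs and `l` give the terms `x₀²`, `x₀ l` and the linear
input terms the same order in `s`. -/
theorem Family.hasDerivAt_curve (f : Family k) (z : ℝ) (v : Fin k → ℝ) (μ s : ℝ) :
    HasDerivAt (fun s : ℝ => f.toFun (s * z, (s ^ 2) • v, s * μ))
      (fderiv ℝ f.toFun (s * z, (s ^ 2) • v, s * μ) (z, (2 * s) • v, μ)) s := by
  have h1 : HasDerivAt (fun s : ℝ => ((s * z, (s ^ 2) • v, s * μ) : ℝ × (Fin k → ℝ) × ℝ))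
      (z, (2 * s) • v, μ) s := by
    refine HasDerivAt.prodMk (by simpa using (hasDerivAt_id s).mul_const z)
      (HasDerivAt.prodMk ?_ (by simpa using (hasDerivAt_id s).mul_const μ))
    simpa using (hasDerivAt_pow 2 s).smul_const v
  exact ((f.smooth.differentiable (by simp)) _).hasFDerivAt.comp_hasDerivAt s h1

theorem Family.hasDerivAt_curve_deriv (f : Family k) (z : ℝ) (v : Fin k → ℝ) (μ : ℝ) :
    HasDerivAt (fun s : ℝ => fderiv ℝ f.toFun (s * z, (s ^ 2) • v, s * μ) (z, (2 * s) • v, μ))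
      (fderiv ℝ (fderiv ℝ f.toFun) 0 (z, 0, μ) (z, 0, μ) + 2 * f.inputDeriv v) 0 := by
  have hd : ContDiff ℝ ∞ (fderiv ℝ f.toFun) := f.smooth.fderiv_right (by simp)
  have h1 : HasDerivAt (fun s : ℝ => ((s * z, (s ^ 2) • v, s * μ) : ℝ × (Fin k → ℝ) × ℝ))
      (z, 0, μ) 0 := by
    refine HasDerivAt.prodMk (by simpa using (hasDerivAt_id (0 : ℝ)).mul_const z)
      (HasDerivAt.prodMk ?_ (by simpa using (hasDerivAt_id (0 : ℝ)).mul_const μ))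
    simpa using (hasDerivAt_pow 2 (0 : ℝ)).smul_const v
  have h2 : HasDerivAt (fun s : ℝ => ((z, (2 * s) • v, μ) : ℝ × (Fin k → ℝ) × ℝ))
      (0, (2 : ℝ) • v, 0) 0 := by
    refine HasDerivAt.prodMk (hasDerivAt_const _ _)
      (HasDerivAt.prodMk ?_ (hasDerivAt_const _ _))
    simpa using ((hasDerivAt_id (0 : ℝ)).const_mul 2).smul_const v
  have h3 := ((hd.differentiable (by simp)) ((0 : ℝ) * z, ((0 : ℝ) ^ 2) • v, (0 : ℝ) * μ)
    ).hasFDerivAt.comp_hasDerivAt 0 h1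
  have h4 := h3.clm_apply h2
  have e1 : (((0 : ℝ) * z, ((0 : ℝ) ^ 2) • v, (0 : ℝ) * μ) : ℝ × (Fin k → ℝ) × ℝ) = 0 := by
    ext <;> simp
  have e2 : ((0, (2 : ℝ) • v, 0) : ℝ × (Fin k → ℝ) × ℝ) = (2 : ℝ) • (0, v, 0) := by ext <;> simp
  simp only [Function.comp_apply, e1, e2, map_smul, smul_eq_mul, mul_zero, zero_smul] at h4
  exact h4

theorem Family.second_deriv_curve (f : Family k) (z μ : ℝ) :
    fderiv ℝ (fderiv ℝ f.toFun) 0 (z, 0, μ) (z, 0, μ) =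
      z ^ 2 * f.coeffXX + 2 * (z * μ) * f.coeffXL := by
  -- There is no pure `l²` term, because `f` vanishes identically on the `l`-axis.
  have hll : fderiv ℝ (fderiv ℝ f.toFun) 0 (0, 0, 1) (0, 0, 1) = 0 := by
    have h1 := f.hasDerivAt_curve_deriv 0 0 1
    have h2 : (fun s : ℝ => fderiv ℝ f.toFun (s * 0, (s ^ 2) • (0 : Fin k → ℝ), s * 1)
        (0, (2 * s) • (0 : Fin k → ℝ), 1)) = fun _ => 0 := by
      funext s
      refine (f.hasDerivAt_curve 0 0 1 s).unique ?_
      simpa [f.map_zero] using hasDerivAt_const s (0 : ℝ)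
    rw [h2] at h1
    have h3 := h1.unique (hasDerivAt_const (0 : ℝ) (0 : ℝ))
    have h4 : f.inputDeriv 0 = 0 := by
      unfold Family.inputDeriv
      exact (fderiv ℝ f.toFun 0).map_zero
    rw [h4] at h3
    simpa using h3
  have hsym : fderiv ℝ (fderiv ℝ f.toFun) 0 (0, 0, 1) (1, 0, 0) = f.coeffXL :=
    (f.smooth.contDiffAt.isSymmSndFDerivAt
      (by
        rw [minSmoothness_of_isRCLikeNormedField]
        exact WithTop.coe_le_coe.2 (le_top : (2 : ℕ∞) ≤ ⊤))) _ _
  have e : ((z, 0, μ) : ℝ × (Fin k → ℝ) × ℝ) = z • (1, 0, 0) + μ • (0, 0, 1) := by ext <;> simp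
  rw [e]
  simp only [map_add, map_smul, add_apply, smul_apply, smul_eq_mul, hll, hsym]
  unfold Family.coeffXX Family.coeffXL
  ring

/-- The rescaling of a family in `𝒱₀` around the origin. -/
theorem Family.exists_rescaling {f : Family k} (hf : f ∈ V0 k) :
    ∃ H : ℝ × (ℝ × (Fin k → ℝ) × ℝ) → ℝ, ContDiff ℝ ∞ H ∧
      (∀ s z v μ, f.toFun (s * z, (s ^ 2) • v, s * μ) = s ^ 2 * H (s, z, v, μ)) ∧
      ∀ z v μ, H (0, z, v, μ) = f.coeffXX / 2 * z ^ 2 + f.coeffXL * (z * μ) + f.inputDeriv v := by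
  have hG : ContDiff ℝ ∞ (fun p : ℝ × (ℝ × (Fin k → ℝ) × ℝ) =>
      f.toFun (p.1 * p.2.1, (p.1 ^ 2) • p.2.2.1, p.1 * p.2.2.2)) := by
    refine f.smooth.comp ?_
    fun_prop
  obtain ⟨H₁, hH₁, h₁⟩ := exists_contDiff_eq_mul hG (by
    intro y
    simpa using f.map_zero 0)
  -- A second division by `s` is possible: the first-order term is `z ∂f/∂x₀ + μ ∂f/∂l`, where the
  -- first derivative vanishes by `f ∈ V0 k` and the second because `f` is zero on the `l`-axis.
  have hz : ∀ y, H₁ (0, y) = 0 := by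
    rintro ⟨z, v, μ⟩
    have d1 := f.hasDerivAt_curve z v μ 0
    have d2 : HasDerivAt (fun s : ℝ => s * H₁ (s, z, v, μ)) (H₁ (0, z, v, μ)) 0 := by
      have : DifferentiableAt ℝ (fun s : ℝ => H₁ (s, z, v, μ)) 0 :=
        ((hH₁.comp (by fun_prop : ContDiff ℝ ∞ fun s : ℝ => (s, z, v, μ))).differentiable
          (by simp)) 0
      simpa using (hasDerivAt_id (0 : ℝ)).fun_mul this.hasDerivAt
    have e : (fun s : ℝ => f.toFun (s * z, (s ^ 2) • v, s * μ)) =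
        fun s : ℝ => s * H₁ (s, z, v, μ) := funext fun s => h₁ s (z, v, μ)
    rw [e] at d1
    rw [d2.unique d1]
    have e1 : (((0 : ℝ) * z, ((0 : ℝ) ^ 2) • v, (0 : ℝ) * μ) : ℝ × (Fin k → ℝ) × ℝ) = 0 := by
      ext <;> simp
    have e2 : ((z, (2 * (0 : ℝ)) • v, μ) : ℝ × (Fin k → ℝ) × ℝ) =
        z • (1, 0, 0) + μ • (0, 0, 1) := by ext <;> simp
    have e3 : fderiv ℝ f.toFun 0 (0, 0, 1) = 0 := by
      have d3 := f.hasDerivAt_curve 0 0 1 0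
      have d4 : (fun s : ℝ => f.toFun (s * 0, (s ^ 2) • (0 : Fin k → ℝ), s * 1)) = fun _ => 0 := by
        funext s
        simpa using f.map_zero s
      rw [d4] at d3
      have d5 := d3.unique (hasDerivAt_const (0 : ℝ) (0 : ℝ))
      have e4 : (((0 : ℝ) * 0, ((0 : ℝ) ^ 2) • (0 : Fin k → ℝ), (0 : ℝ) * 1) :
        ℝ × (Fin k → ℝ) × ℝ) = 0 := by ext <;> simp
      rw [e4, smul_zero] at d5
      exact d5
    rw [e1, e2, map_add, map_smul, map_smul, Family.fderiv_x_eq_zero hf, e3]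
    simp
  obtain ⟨H, hH, h₂⟩ := exists_contDiff_eq_mul hH₁ hz
  have key : ∀ s z v μ, f.toFun (s * z, (s ^ 2) • v, s * μ) = s ^ 2 * H (s, z, v, μ) := by
    intro s z v μ
    have := h₁ s (z, v, μ)
    rw [h₂] at this
    rw [pow_two s, mul_assoc, ← this, ← pow_two]
  refine ⟨H, hH, key, fun z v μ => ?_⟩
  set h : ℝ → ℝ := fun s => H (s, z, v, μ) with hh
  have hs : ContDiff ℝ ∞ h := hH.comp (by fun_prop : ContDiff ℝ ∞ fun s : ℝ => (s, z, v, μ))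
  have hs' : ContDiff ℝ ∞ (_root_.deriv h) := (contDiff_infty_iff_deriv.1 hs).2
  -- Comparing second derivatives of `f` along the curve and of `s² h(s)` at `s = 0` identifies `2
  -- h(0)`.
  have d1 : ∀ s, fderiv ℝ f.toFun (s * z, (s ^ 2) • v, s * μ) (z, (2 * s) • v, μ) =
      s * (2 * h s + s * _root_.deriv h s) := by
    intro s
    refine (f.hasDerivAt_curve z v μ s).unique ?_
    rw [show (fun s : ℝ => f.toFun (s * z, (s ^ 2) • v, s * μ)) = fun s => s ^ 2 * h s from
      funext fun s => key s z v μ]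
    have := (hasDerivAt_pow 2 s).fun_mul ((hs.differentiable (by simp)) s).hasDerivAt
    refine this.congr_deriv ?_
    push_cast
    ring
  have d2 := f.hasDerivAt_curve_deriv z v μ
  simp only [d1] at d2
  have d3 : HasDerivAt (fun s => s * (2 * h s + s * _root_.deriv h s)) (2 * h 0) 0 := by
    have : DifferentiableAt ℝ (fun s => 2 * h s + s * _root_.deriv h s) 0 :=
      ((by fun_prop : ContDiff ℝ ∞ fun s => 2 * h s + s * _root_.deriv h s).differentiable
        (by simp)) 0
    simpa using (hasDerivAt_id (0 : ℝ)).fun_mul this.hasDerivAt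
  have d4 := d3.unique d2
  rw [Family.second_deriv_curve f z μ] at d4
  change h 0 = _
  linarith

/-- Solving the equilibrium equation of a cell whose inputs are given. -/
theorem Family.exists_root {f : Family k} (hf : f ∈ V0 k) {V : ℝ → Fin k → ℝ} {M : ℝ → ℝ}
    (hV : ∀ᶠ s in 𝓝 (0 : ℝ), ContDiffAt ℝ ∞ V s) (hM : ∀ᶠ s in 𝓝 (0 : ℝ), ContDiffAt ℝ ∞ M s)
    {z₀ : ℝ}
    (h0 : f.coeffXX / 2 * z₀ ^ 2 + f.coeffXL * (z₀ * M 0) + f.inputDeriv (V 0) = 0)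
    (h1 : f.coeffXX * z₀ + f.coeffXL * M 0 ≠ 0) :
    ∃ w : ℝ → ℝ, w 0 = z₀ ∧ ∀ᶠ s in 𝓝 (0 : ℝ), ContDiffAt ℝ ∞ w s ∧
      f.toFun (s * w s, (s ^ 2) • V s, s * M s) = 0 := by
  obtain ⟨H, hH, hfH, hH0⟩ := Family.exists_rescaling hf
  set Φ : (ℝ × (Fin k → ℝ) × ℝ) × ℝ → ℝ := fun u => H (u.1.1, u.2, u.1.2.1, u.1.2.2) with hΦ
  have hΦs : ContDiff ℝ ∞ Φ := hH.comp (by fun_prop)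
  -- With the factor `s²` removed, the equation is regular at `s = 0`: its `z`-derivative there is
  -- the quantity assumed nonzero in `h1`.
  have hd : fderiv ℝ Φ ((0, V 0, M 0), z₀) (0, 1) = f.coeffXX * z₀ + f.coeffXL * M 0 := by
    have a1 : HasDerivAt (fun z : ℝ => (((0, V 0, M 0), z) : (ℝ × (Fin k → ℝ) × ℝ) × ℝ)) (0, 1) z₀ :=
      (hasDerivAt_const _ _).prodMk (hasDerivAt_id z₀)
    have a2 := ((hΦs.differentiable (by simp)) ((0, V 0, M 0), z₀)).hasFDerivAt.comp_hasDerivAt z₀ a1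
    refine a2.unique ?_
    have a3 : (Φ ∘ fun z : ℝ => (((0, V 0, M 0), z) : (ℝ × (Fin k → ℝ) × ℝ) × ℝ)) =
        fun z => f.coeffXX / 2 * z ^ 2 + f.coeffXL * (z * M 0) + f.inputDeriv (V 0) :=
      funext fun z => hH0 z (V 0) (M 0)
    rw [a3]
    have := (((hasDerivAt_pow 2 z₀).const_mul (f.coeffXX / 2)).add
      (((hasDerivAt_id z₀).mul_const (M 0)).const_mul f.coeffXL)).add_const (f.inputDeriv (V 0))
    convert this using 1
    simp
    ring
  obtain ⟨ζ, hζ0, hζ⟩ := exists_smooth_implicit hΦs (q₀ := (0, V 0, M 0)) (z₀ := z₀)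
    ((hH0 z₀ (V 0) (M 0)).trans h0) (by rwa [hd])
  have hc : ContinuousAt (fun s : ℝ => (s, V s, M s)) 0 :=
    continuousAt_id.prodMk (hV.self_of_nhds.continuousAt.prodMk hM.self_of_nhds.continuousAt)
  refine ⟨fun s => ζ (s, V s, M s), hζ0, ?_⟩
  filter_upwards [hV, hM, hc.eventually hζ] with s hVs hMs hζs
  refine ⟨hζs.2.comp s (contDiffAt_id.prodMk (hVs.prodMk hMs)), ?_⟩
  rw [hfH, show H (s, ζ (s, V s, M s), V s, M s) = 0 from hζs.1, mul_zero]

/-! ### Genericity -/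

theorem continuous_iteratedFDeriv_apply (n : ℕ) (v : Fin n → ℝ × (Fin k → ℝ) × ℝ) :
    Continuous fun f : Family k => iteratedFDeriv ℝ n f.toFun 0 v := by
  have h1 : Continuous (Family.deriv (k := k) n) :=
    continuous_iff_le_induced.2 (iInf_le _ n)
  have h2 : Continuous fun f : Family k => Family.deriv n f 0 :=
    (continuous_eval_const (0 : ℝ × (Fin k → ℝ) × ℝ)).comp h1
  exact (ContinuousMultilinearMap.apply ℝ _ ℝ v).continuous.comp h2

theorem continuous_coeffXX : Continuous (Family.coeffXX (k := k)) := by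
  have := continuous_iteratedFDeriv_apply (k := k) 2 ![(1, 0, 0), (1, 0, 0)]
  simp only [iteratedFDeriv_two_apply] at this
  exact this

theorem continuous_coeffXL : Continuous (Family.coeffXL (k := k)) := by
  have := continuous_iteratedFDeriv_apply (k := k) 2 ![(1, 0, 0), (0, 0, 1)]
  simp only [iteratedFDeriv_two_apply] at this
  exact this

theorem continuous_inputDeriv (v : Fin k → ℝ) : Continuous fun f : Family k => f.inputDeriv v := by
  have := continuous_iteratedFDeriv_apply (k := k) 1 ![(0, v, 0)]
  simp only [iteratedFDeriv_one_apply] at this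
  exact this

theorem isOpen_nondegenerate : IsOpen {f : V0 k | (f : Family k).Nondegenerate} := by
  have : {f : V0 k | (f : Family k).Nondegenerate} =
      {f : V0 k | (f : Family k).coeffXX ≠ 0} ∩ ({f : V0 k | (f : Family k).coeffXL ≠ 0} ∩
        ⋂ A : {A : Finset (Fin k) // A.Nonempty},
          {f : V0 k | (f : Family k).inputDeriv (fun i => if i ∈ A.1 then 1 else 0) ≠ 0}) := by
    ext f
    simp only [mem_inter_iff, mem_iInter, mem_ofPred_eq, Subtype.forall]
    exact ⟨fun h => ⟨h.1, h.2, h.3⟩, fun h => ⟨h.1, h.2.1, h.2.2⟩⟩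
  rw [this]
  refine (isOpen_ne_fun (continuous_coeffXX.comp continuous_subtype_val) continuous_const).inter
    ((isOpen_ne_fun (continuous_coeffXL.comp continuous_subtype_val) continuous_const).inter
      (isOpen_iInter_of_finite fun A => isOpen_ne_fun
        ((continuous_inputDeriv _).comp continuous_subtype_val) continuous_const))

/-- The nondegenerate polynomial `x₀² / 2 + x₀ l + ∑ i, x_i`. -/
noncomputable def model (k : ℕ) : ℝ × (Fin k → ℝ) × ℝ → ℝ :=
  fun p => p.1 ^ 2 / 2 + p.1 * p.2.2 + ∑ i, p.2.1 i

theorem contDiff_model (k : ℕ) : ContDiff ℝ ∞ (model k) := by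
  unfold model
  fun_prop

/-- The perturbation `f + ε g` of a family `f`, where `g` is the model polynomial. -/
noncomputable def Family.perturb (f : Family k) (ε : ℝ) : Family k where
  toFun := f.toFun + ε • model k
  smooth := f.smooth.add ((contDiff_model k).const_smul ε)
  map_zero l := by simp [f.map_zero, model]

theorem Family.fderiv_perturb (f : Family k) (ε : ℝ) :
    fderiv ℝ (f.perturb ε).toFun = fderiv ℝ f.toFun + ε • fderiv ℝ (model k) := by
  funext p
  have h1 := (f.smooth.differentiable (by simp)) p
  have h2 := ((contDiff_model k).differentiable (by simp)) p
  change fderiv ℝ (f.toFun + ε • model k) p = _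
  rw [fderiv_add h1 (h2.const_smul ε), fderiv_const_smul h2]
  rfl

theorem Family.fderiv_fderiv_perturb (f : Family k) (ε : ℝ) :
    fderiv ℝ (fderiv ℝ (f.perturb ε).toFun) 0 =
      fderiv ℝ (fderiv ℝ f.toFun) 0 + ε • fderiv ℝ (fderiv ℝ (model k)) 0 := by
  have h1 := ((f.smooth.fderiv_right (m := ∞) (by simp)).differentiable (by simp)) 0
  have h2 := (((contDiff_model k).fderiv_right (m := ∞) (by simp)).differentiable (by simp)) 0
  rw [Family.fderiv_perturb, fderiv_add h1 (h2.const_smul ε), fderiv_const_smul h2]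

theorem fderiv_model (p u : ℝ × (Fin k → ℝ) × ℝ) :
    fderiv ℝ (model k) p u = p.1 * u.1 + (p.1 * u.2.2 + u.1 * p.2.2) + ∑ i, u.2.1 i := by
  have h1 : HasDerivAt (fun t : ℝ => p + t • u) u 0 := by
    simpa using ((hasDerivAt_id (0 : ℝ)).smul_const u).const_add p
  have h2 := (((contDiff_model k).differentiable (by simp)) (p + (0 : ℝ) • u)
    ).hasFDerivAt.comp_hasDerivAt 0 h1
  have h3 : (model k ∘ fun t : ℝ => p + t • u) = fun t : ℝ => model k p +
      t * (p.1 * u.1 + (p.1 * u.2.2 + u.1 * p.2.2) + ∑ i, u.2.1 i) +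
      t ^ 2 * (u.1 ^ 2 / 2 + u.1 * u.2.2) := by
    funext t
    simp only [model, Function.comp_apply, Prod.fst_add, Prod.snd_add, Prod.smul_fst,
      Prod.smul_snd, Pi.add_apply, Pi.smul_apply, smul_eq_mul, Finset.sum_add_distrib,
      ← Finset.mul_sum]
    ring
  have h4 := (((hasDerivAt_id (0 : ℝ)).mul_const
    (p.1 * u.1 + (p.1 * u.2.2 + u.1 * p.2.2) + ∑ i, u.2.1 i)).const_add (model k p)).add
    ((hasDerivAt_pow 2 (0 : ℝ)).mul_const (u.1 ^ 2 / 2 + u.1 * u.2.2))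
  rw [h3] at h2
  simpa using h2.unique h4

theorem fderiv_fderiv_model (u w : ℝ × (Fin k → ℝ) × ℝ) :
    fderiv ℝ (fderiv ℝ (model k)) 0 u w = u.1 * w.1 + (u.1 * w.2.2 + w.1 * u.2.2) := by
  have h1 : HasDerivAt (fun t : ℝ => t • u) u 0 := by
    simpa using (hasDerivAt_id (0 : ℝ)).smul_const u
  have h2 := ((((contDiff_model k).fderiv_right (m := ∞) (by simp)).differentiable (by simp))
    ((0 : ℝ) • u)).hasFDerivAt.comp_hasDerivAt 0 h1
  have h3 := h2.clm_apply (hasDerivAt_const (0 : ℝ) w)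
  have h4 : (fun t : ℝ => (fderiv ℝ (model k) ∘ fun t : ℝ => t • u) t w) = fun t : ℝ =>
      t * (u.1 * w.1 + (u.1 * w.2.2 + w.1 * u.2.2)) + ∑ i, w.2.1 i := by
    funext t
    simp only [Function.comp_apply, fderiv_model, Prod.smul_fst, Prod.smul_snd, smul_eq_mul]
    ring
  rw [h4] at h3
  have h5 := ((hasDerivAt_id (0 : ℝ)).mul_const
    (u.1 * w.1 + (u.1 * w.2.2 + w.1 * u.2.2))).add_const (∑ i, w.2.1 i)
  simpa using h3.unique h5

theorem Family.coeffXX_perturb (f : Family k) (ε : ℝ) :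
    (f.perturb ε).coeffXX = f.coeffXX + ε := by
  simp [Family.coeffXX, Family.fderiv_fderiv_perturb, fderiv_fderiv_model]

theorem Family.coeffXL_perturb (f : Family k) (ε : ℝ) :
    (f.perturb ε).coeffXL = f.coeffXL + ε := by
  simp [Family.coeffXL, Family.fderiv_fderiv_perturb, fderiv_fderiv_model]

theorem Family.inputDeriv_perturb (f : Family k) (ε : ℝ) (v : Fin k → ℝ) :
    (f.perturb ε).inputDeriv v = f.inputDeriv v + ε * ∑ i, v i := by
  simp [Family.inputDeriv, Family.fderiv_perturb, fderiv_model]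

theorem Family.perturb_mem {f : Family k} (hf : f ∈ V0 k) (ε : ℝ) : f.perturb ε ∈ V0 k := by
  have h1 : HasDerivAt (fun x : ℝ => ((x, 0, 0) : ℝ × (Fin k → ℝ) × ℝ)) (1, 0, 0) 0 :=
    (hasDerivAt_id (0 : ℝ)).prodMk (hasDerivAt_const (0 : ℝ) ((0, 0) : (Fin k → ℝ) × ℝ))
  have h2 := (((f.perturb ε).smooth.differentiable (by simp)) (0, 0, 0)
    ).hasFDerivAt.comp_hasDerivAt 0 h1
  change _root_.deriv ((f.perturb ε).toFun ∘ fun x : ℝ => (x, 0, 0)) 0 = 0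
  rw [h2.deriv, Family.fderiv_perturb]
  have := Family.fderiv_x_eq_zero hf
  simp only [Pi.add_apply, Pi.smul_apply, add_apply, smul_apply, fderiv_model]
  rw [show ((0, 0, 0) : ℝ × (Fin k → ℝ) × ℝ) = 0 from rfl, this]
  simp

theorem Family.perturb_zero (f : Family k) : f.perturb 0 = f := by
  cases f
  simp [Family.perturb]

theorem Family.continuous_perturb (f : Family k) : Continuous f.perturb := by
  refine continuous_iInf_rng.2 fun n => continuous_induced_rng.2 ?_
  set g : C(ℝ × (Fin k → ℝ) × ℝ,
      ContinuousMultilinearMap ℝ (fun _ : Fin n => ℝ × (Fin k → ℝ) × ℝ) ℝ) :=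
    ⟨iteratedFDeriv ℝ n (model k),
      (contDiff_model k).continuous_iteratedFDeriv (by exact_mod_cast le_top)⟩ with hg
  have : Family.deriv n ∘ f.perturb = fun ε : ℝ => Family.deriv n f + ε • g := by
    funext ε
    ext1 p
    have h1 : ContDiffAt ℝ n f.toFun p := (f.smooth.of_le (by exact_mod_cast le_top)).contDiffAt
    have h2 : ContDiffAt ℝ n (model k) p :=
      ((contDiff_model k).of_le (by exact_mod_cast le_top)).contDiffAt
    change iteratedFDeriv ℝ n (f.toFun + ε • model k) p = _
    have h3 : ContDiffAt ℝ n (ε • model k) p := h2.const_smul ε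
    rw [iteratedFDeriv_add_apply h1 h3,
      iteratedFDeriv_const_smul_apply h2]
    rfl
  rw [this]
  fun_prop

/-- Along `f + ε • model k`, which stays in `V0 k`, each condition reads `α + ε β ≠ 0` with `β ≠ 0`;
these finitely many conditions hold for all small `ε ≠ 0`. -/
theorem dense_nondegenerate : Dense {f : V0 k | (f : Family k).Nondegenerate} := by
  intro f
  set P : ℝ → V0 k := fun ε => ⟨(f : Family k).perturb ε, Family.perturb_mem f.2 ε⟩ with hP
  have hPc : Continuous P := (Family.continuous_perturb _).subtype_mk _
  have hP0 : P 0 = f := Subtype.ext (Family.perturb_zero _)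
  have hne : ∀ a b : ℝ, b ≠ 0 → ∀ᶠ ε in 𝓝[≠] (0 : ℝ), a + ε * b ≠ 0 := by
    intro a b hb
    by_cases ha : a = 0
    · filter_upwards [self_mem_nhdsWithin] with ε hε
      simpa [ha, hb] using hε
    · refine nhdsWithin_le_nhds ?_
      have : ContinuousAt (fun ε : ℝ => a + ε * b) 0 := by fun_prop
      exact this.eventually_ne (by simpa using ha)
  have hA : ∀ᶠ ε in 𝓝[≠] (0 : ℝ), ∀ A : Finset (Fin k), A.Nonempty →
      (f : Family k).inputDeriv (fun i => if i ∈ A then 1 else 0) +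
        ε * ∑ i, (if i ∈ A then (1 : ℝ) else 0) ≠ 0 := by
    rw [eventually_all]
    intro A
    by_cases hA : A.Nonempty
    · filter_upwards [hne ((f : Family k).inputDeriv (fun i => if i ∈ A then 1 else 0))
        (∑ i, (if i ∈ A then (1 : ℝ) else 0)) (by simpa using hA.ne_empty)] with ε hε _ using hε
    · exact Eventually.of_forall fun _ h => absurd h hA
  have hall : ∀ᶠ ε in 𝓝[≠] (0 : ℝ), P ε ∈ {f : V0 k | (f : Family k).Nondegenerate} := by
    filter_upwards [hA, hne (f : Family k).coeffXX 1 one_ne_zero,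
      hne (f : Family k).coeffXL 1 one_ne_zero] with ε h1 h2 h3
    refine ⟨?_, ?_, fun A hA => ?_⟩
    · simpa [hP, Family.coeffXX_perturb] using h2
    · simpa [hP, Family.coeffXL_perturb] using h3
    · simpa [hP, Family.inputDeriv_perturb] using h1 A hA
  have ht : Tendsto P (𝓝[≠] 0) (𝓝 f) := by
    have := hPc.tendsto 0
    rw [hP0] at this
    exact this.mono_left nhdsWithin_le_nhds
  exact mem_closure_of_tendsto ht hall

/-! ### Quotient maps between feed-forward networks -/

/-- A network fibration from `L` onto `N`. -/
structure IsQuotientMap (L : Network k C') (N : Network k C) (φ : C' → C) : Prop where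
  surjective : Function.Surjective φ
  map_source : ∀ i c, φ (L.σ i c) = N.σ i (φ c)

theorem Network.Balanced.exists_isQuotientMap {L : Network k C'} {N : Network k C} {s : Setoid C'}
    (h : L.Balanced s) (hs : (L.quotient s h).Same N) :
    ∃ φ : C' → C, IsQuotientMap L N φ ∧ ∀ c c', φ c = φ c' → s c c' := by
  obtain ⟨e, he⟩ := hs
  refine ⟨fun c => e (Quotient.mk s c), ⟨?_, fun i c => ?_⟩, fun c c' hc => ?_⟩
  · exact e.surjective.comp Quotient.mk_surjective
  · exact he i (Quotient.mk s c)
  · exact Quotient.exact (e.injective hc)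

section

variable {N : Network k C} {L : Network k C'} {m j : ℕ} {layer : C → ℕ} {layer' : C' → ℕ}
  {φ ψ : C' → C}

/-- A layer-0 cell is fixed by `σ i`, hence so is its image, whereas `σ i` moves every cell of
positive layer. Higher layers follow by applying `σ i`. -/
theorem IsQuotientMap.layer_le (hφ : IsQuotientMap L N φ) (hN : IsFeedForward N m layer)
    (hL : IsFeedForward L m layer') (i : Fin k) (c : C') : layer (φ c) ≤ layer' c := by
  induction hl : layer' c generalizing c with
  | zero =>
    by_contra hne
    obtain ⟨t, ht⟩ := Nat.exists_eq_succ_of_ne_zero (show layer (φ c) ≠ 0 by omega)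
    have h1 := hN.next_layer _ _ ht i
    rw [← hφ.map_source, hL.first_layer c hl] at h1
    omega
  | succ l ih =>
    rcases ht : layer (φ c) with _ | t
    · exact Nat.zero_le _
    · have h1 := hN.next_layer _ _ ht i
      rw [← hφ.map_source] at h1
      have := ih _ (hL.next_layer c l hl i)
      omega

/-- A preimage of a top cell lies in the top layer by `IsQuotientMap.layer_le`; descending along `σ
i` lowers both layers together. -/
theorem IsQuotientMap.exists_layer_eq (hφ : IsQuotientMap L N φ) (hN : IsFeedForward N m layer)
    (hL : IsFeedForward L m layer') (i : Fin k) (q t : ℕ) (hq : t + q = m) :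
    ∃ c, layer' c = t ∧ layer (φ c) = t := by
  induction q generalizing t with
  | zero =>
    obtain ⟨x, hx⟩ := hN.layer_nonempty m le_rfl
    obtain ⟨c, rfl⟩ := hφ.surjective x
    have h1 := hφ.layer_le hN hL i c
    have h2 := hL.layer_le c
    exact ⟨c, by omega, by omega⟩
  | succ q ih =>
    obtain ⟨c, h1, h2⟩ := ih (t + 1) (by omega)
    exact ⟨L.σ i c, hL.next_layer c t h1 i, by
      rw [hφ.map_source]; exact hN.next_layer _ t h2 i⟩

/-- The data determined by a quotient map below a layer of `L` with a unique cell `d`, mapped to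
the unique cell `x` of the same layer of `N`. -/
theorem IsQuotientMap.apply_eq (hφ : IsQuotientMap L N φ) (hψ : IsQuotientMap L N ψ)
    (hL : IsFeedForward L m layer') (hjm : j < m) {d : C'} (hd : ∀ c, layer' c = j + 1 → c = d)
    (hd' : φ d = ψ d) (c : C') (hc : layer' c = j) : φ c = ψ c := by
  obtain ⟨c', i, h1, rfl⟩ := hL.source c (by omega)
  rw [hd c' (by omega), hφ.map_source, hψ.map_source, hd']

theorem exists_pair_of_isLiftInsideLayer [Finite C] [Finite C']
    (hN : IsFeedForward N m layer) (hL : IsFeedForward L m layer')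
    (h : IsLiftInsideLayer N m layer L m layer' j) (hjm : j < m)
    (hcard : layerCard layer (j + 1) = 1) :
    ∃ d, layer' d = j + 1 ∧ (∀ c, layer' c = j + 1 → c = d) ∧
      ∃ a a', a ≠ a' ∧ layer' a = j ∧ layer' a' = j ∧
        ∀ (s : Setoid C') (hs : L.Balanced s), (L.quotient s hs).Same N → s a a' := by
  -- Since `0 < m`, a layer-0 cell is the source of an edge, which supplies an edge type `i₀`.
  obtain ⟨x₀, hx₀⟩ := hN.layer_nonempty 0 (Nat.zero_le _)
  obtain ⟨-, i₀, -, -⟩ := hN.source x₀ (by omega)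
  have hcard' : layerCard layer' (j + 1) = 1 := by
    rw [h.card_eq (j + 1) hjm (by omega), hcard]
  obtain ⟨x, hx⟩ := Set.ncard_eq_one.1 hcard
  obtain ⟨d, hd⟩ := Set.ncard_eq_one.1 hcard'
  have hx1 : layer x = j + 1 := (Set.ext_iff.1 hx x).2 rfl
  have hx2 : ∀ c, layer c = j + 1 → c = x := fun c hc => (Set.ext_iff.1 hx c).1 hc
  have hd1 : layer' d = j + 1 := (Set.ext_iff.1 hd d).2 rfl
  have hd2 : ∀ c, layer' c = j + 1 → c = d := fun c hc => (Set.ext_iff.1 hd c).1 hc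
  have hdx : ∀ {φ : C' → C}, IsQuotientMap L N φ → φ d = x := by
    intro φ hφ
    obtain ⟨c, h1, h2⟩ := hφ.exists_layer_eq hN hL i₀ (m - (j + 1)) (j + 1) (by omega)
    rw [← hd2 c h1]
    exact hx2 _ h2
  obtain ⟨s, hs, hsN⟩ := h.lift
  obtain ⟨φ, hφ, -⟩ := hs.exists_isQuotientMap hsN
  have himage : φ '' {c | layer' c = j} = {c | layer c = j} := by
    ext y
    constructor
    · rintro ⟨c, hc, rfl⟩
      obtain ⟨c', i, h1, rfl⟩ := hL.source c (by rw [show layer' c = j from hc]; exact hjm)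
      rw [show layer' (L.σ i c') = j from hc] at h1
      change layer (φ (L.σ i c')) = j
      rw [hd2 c' h1, hφ.map_source, hdx hφ]
      exact hN.next_layer x j hx1 i
    · intro hy
      obtain ⟨y', i, h1, h2⟩ := hN.source y (by rw [show layer y = j from hy]; exact hjm)
      rw [show layer y = j from hy] at h1
      refine ⟨L.σ i d, hL.next_layer d j hd1 i, ?_⟩
      rw [hφ.map_source, hdx hφ, h2, hx2 y' h1]
  have hninj : ¬ InjOn φ {c | layer' c = j} := by
    intro hinj
    apply h.card_ne
    unfold layerCard
    rw [← himage, hinj.ncard_image]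
  simp only [InjOn] at hninj
  push Not at hninj
  obtain ⟨a, ha, a', ha', haa, hne⟩ := hninj
  refine ⟨d, hd1, hd2, a, a', hne, ha, ha', fun s' hs' hs'N => ?_⟩
  obtain ⟨ψ, hψ, hψs⟩ := hs'.exists_isQuotientMap hs'N
  have hdd : ψ d = φ d := by rw [hdx hψ, hdx hφ]
  apply hψs
  rw [hψ.apply_eq hφ hL hjm hd2 hdd a ha, hψ.apply_eq hφ hL hjm hd2 hdd a' ha', haa]

end

/-! ### Construction of the branch -/

theorem Family.inputDeriv_smul (f : Family k) (r : ℝ) (v : Fin k → ℝ) :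
    f.inputDeriv (r • v) = r * f.inputDeriv v := by
  unfold Family.inputDeriv
  rw [← smul_eq_mul, ← map_smul]
  simp

/-- Of the two opposite roots, one satisfies the sign condition, which is the hypothesis `hac` for
the next fold, with `b * z` as the new `c`. -/
theorem exists_sqrt_with_sign {a b c : ℝ} (hac : a * c < 0) (hb : b ≠ 0) :
    ∃ z : ℝ, a / 2 * z ^ 2 + c = 0 ∧ a * (b * z) < 0 := by
  have ha : a ≠ 0 := by rintro rfl; simp at hac
  have hpos : 0 < -2 * c / a := by
    have : -2 * c / a = -2 * (a * c) / a ^ 2 := by field_simp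
    rw [this]
    have := sq_pos_of_ne_zero ha
    exact div_pos (by linarith) this
  have hs := Real.sq_sqrt hpos.le
  have hs' := Real.sqrt_pos.2 hpos
  have heq : a / 2 * √(-2 * c / a) ^ 2 + c = 0 := by
    rw [hs]
    field_simp
    ring
  rcases lt_or_gt_of_ne (mul_ne_zero ha hb) with h | h
  · exact ⟨√(-2 * c / a), heq, by rw [← mul_assoc]; exact mul_neg_of_neg_of_pos h hs'⟩
  · exact ⟨-√(-2 * c / a), by rw [neg_sq]; exact heq, by
      rw [← mul_assoc]; exact mul_neg_of_pos_of_neg h (neg_lt_zero.2 hs')⟩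

/-- `B t` is an equilibrium for the parameter value `l = e * t ^ (2 ^ p)` as far as the cells of
the layers up to `l` are concerned, all the cells of the layer `l` have the same value `t * w t`,
with a sign which allows to continue to the next layer, and `B` separates the cells `a`, `a'`. -/
structure IsPartialBranch (L : Network k C') (f : Family k) (layer : C' → ℕ) (a a' : C') (e : ℝ)
    (l p : ℕ) (B : ℝ → C' → ℝ) (w : ℝ → ℝ) : Prop where
  smooth : ∀ c, ∀ᶠ t in 𝓝 (0 : ℝ), ContDiffAt ℝ ∞ (fun t => B t c) t
  equilibrium : ∀ c, layer c ≤ l → ∀ᶠ t in 𝓝 (0 : ℝ),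
    f.toFun (B t c, fun i => B t (L.σ i c), e * t ^ (2 ^ p)) = 0
  top : ∀ c, layer c = l → ∀ t, B t c = t * w t
  smooth_top : ∀ᶠ t in 𝓝 (0 : ℝ), ContDiffAt ℝ ∞ w t
  sign : f.coeffXX * (f.inputDeriv (fun _ => 1) * w 0) < 0
  origin : ∀ c, B 0 c = 0
  eq_zero : ∀ t, B t a = 0
  ne_zero : ∀ᶠ t in 𝓝[≠] (0 : ℝ), B t a' ≠ 0

theorem tendsto_mul_sq (e : ℝ) : Tendsto (fun s : ℝ => e * s ^ 2) (𝓝 0) (𝓝 0) :=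
  Continuous.tendsto' (by fun_prop) _ _ (by simp)

theorem tendsto_sq : Tendsto (fun s : ℝ => s ^ 2) (𝓝 0) (𝓝 0) :=
  Continuous.tendsto' (by fun_prop) _ _ (by simp)

theorem IsFeedForward.layer_source_le {L : Network k C'} {m : ℕ} {layer : C' → ℕ}
    (hL : IsFeedForward L m layer) (i : Fin k) (c : C') : layer (L.σ i c) ≤ layer c := by
  rcases h : layer c with _ | t
  · rw [hL.first_layer c h, h]
  · rw [hL.next_layer c t h]
    omega

theorem Family.Nondegenerate.inputDeriv_one_ne {f : Family k} (hf : f.Nondegenerate)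
    (i : Fin k) : f.inputDeriv (fun _ => 1) ≠ 0 := by
  simpa using hf.inputDeriv_ne Finset.univ ⟨i, Finset.mem_univ i⟩

theorem IsPartialBranch.step {L : Network k C'} {f : Family k} (hf : f ∈ V0 k)
    (hnd : f.Nondegenerate) {m : ℕ} {layer : C' → ℕ} (hL : IsFeedForward L m layer) (i₀ : Fin k)
    {a a' : C'} {e : ℝ} {l p : ℕ} {B : ℝ → C' → ℝ} {w : ℝ → ℝ}
    (ha : layer a ≤ l) (ha' : layer a' ≤ l) (h : IsPartialBranch L f layer a a' e l p B w) :
    ∃ B' w', IsPartialBranch L f layer a a' e (l + 1) (p + 1) B' w' := by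
  obtain ⟨z₀, hz₀, hz₀'⟩ := exists_sqrt_with_sign h.sign (hnd.inputDeriv_one_ne i₀)
  have hz₀ne : z₀ ≠ 0 := by rintro rfl; simp at hz₀'
  have hpow : 2 ^ (p + 1) - 1 ≠ 0 := by
    have : 2 ^ 1 ≤ 2 ^ (p + 1) := Nat.pow_le_pow_right (by norm_num) (by omega)
    omega
  have hpow' : 2 ^ (p + 1) - 1 + 1 = 2 ^ (p + 1) := Nat.sub_add_cancel Nat.one_le_two_pow
  -- With `t = s²` the inputs `t w(t)` become `s² w(s²)`, and `l = e s^(2^(p+1))` is `s * M s` with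
  -- `M 0 = 0`, so the parameter drops out of the leading equation.
  obtain ⟨w', hw'0, hw'⟩ := Family.exists_root hf (V := fun s _ => w (s ^ 2))
    (M := fun s => e * s ^ (2 ^ (p + 1) - 1)) (z₀ := z₀)
    (by
      filter_upwards [tendsto_sq.eventually h.smooth_top] with s hs
      exact contDiffAt_pi.2 fun _ => hs.comp s (f := fun s => s ^ 2) (by fun_prop))
    (Eventually.of_forall fun s => by fun_prop)
    (by
      have : (fun _ : Fin k => w ((0 : ℝ) ^ 2)) = w 0 • fun _ => (1 : ℝ) := by
        funext i; simp
      rw [this, Family.inputDeriv_smul, zero_pow hpow]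
      linear_combination hz₀)
    (by
      rw [zero_pow hpow]
      simpa using ⟨hnd.coeffXX_ne, hz₀ne⟩)
  refine ⟨fun s c => if layer c ≤ l then B (s ^ 2) c else s * w' s, w',
    fun c => ?_, fun c hc => ?_, fun c hc t => ?_, ?_, ?_, fun c => ?_, fun t => ?_, ?_⟩
  · by_cases hc : layer c ≤ l
    · simp only [hc, if_true]
      filter_upwards [tendsto_sq.eventually (h.smooth c)] with s hs
      exact hs.comp s (f := fun s => s ^ 2) (by fun_prop)
    · simp only [hc, if_false]
      filter_upwards [hw'] with s hs
      exact contDiffAt_id.mul hs.1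
  · rcases Nat.lt_or_ge l (layer c) with hlt | hle
    · have hcl : layer c = l + 1 := by omega
      have hin : ∀ i, layer (L.σ i c) = l := hL.next_layer c l hcl
      filter_upwards [hw'] with s hs
      simp only [not_le.2 hlt, if_false, hin, le_refl, if_true, h.top _ (hin _)]
      refine Eq.trans (congrArg f.toFun ?_) hs.2
      refine Prod.ext rfl (Prod.ext rfl ?_)
      calc e * s ^ 2 ^ (p + 1) = e * s ^ (2 ^ (p + 1) - 1 + 1) := by rw [hpow']
        _ = s * (e * s ^ (2 ^ (p + 1) - 1)) := by ring
    · filter_upwards [tendsto_sq.eventually (h.equilibrium c hle)] with s hs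
      have hin : ∀ i, layer (L.σ i c) ≤ l := fun i => (hL.layer_source_le i c).trans hle
      simp only [hle, if_true, hin]
      rwa [← pow_mul, ← pow_succ'] at hs
  · simp [hc]
  · filter_upwards [hw'] with s hs using hs.1
  · rwa [hw'0]
  · simp [h.origin]
  · simp only [ha, if_true, h.eq_zero]
  · simp only [ha', if_true]
    have : Tendsto (fun s : ℝ => s ^ 2) (𝓝[≠] 0) (𝓝[≠] 0) :=
      tendsto_nhdsWithin_iff.2 ⟨tendsto_sq.mono_left nhdsWithin_le_nhds, by
        filter_upwards [self_mem_nhdsWithin] with s hs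
        simpa using hs⟩
    exact this.eventually h.ne_zero

theorem exists_isPartialBranch_base {L : Network k C'} {f : Family k} (hf : f ∈ V0 k)
    (hnd : f.Nondegenerate) {m j : ℕ} {layer : C' → ℕ} (hL : IsFeedForward L m layer)
    (hj : 0 < j) (hjm : j < m) {d a a' : C'} (hd : layer d = j + 1)
    (hd' : ∀ c, layer c = j + 1 → c = d) (haa : a ≠ a') (ha : layer a = j) (ha' : layer a' = j) :
    ∃ e : ℝ, (e = 1 ∨ e = -1) ∧ ∃ B w, IsPartialBranch L f layer a a' e (j + 1) 1 B w := by
  classical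
  obtain ⟨d', i₀, hi₁, hi₀⟩ := hL.source a' (by omega)
  obtain rfl : d' = d := hd' d' (by omega)
  have hXX := hnd.coeffXX_ne
  have hXL := hnd.coeffXL_ne
  -- The nonzero root of `coeffXX / 2 * z² + coeffXL * z`: the slope at `l = 0` of the transcritical
  -- branch followed by `a'`.
  set κ : ℝ := -2 * f.coeffXL / f.coeffXX with hκ
  have hκ0 : κ ≠ 0 := div_ne_zero (mul_ne_zero (by norm_num) hXL) hXX
  have hκ1 : f.coeffXX * κ = -2 * f.coeffXL := by rw [hκ]; field_simp
  have hzero : f.inputDeriv (0 : Fin k → ℝ) = 0 := (fderiv ℝ f.toFun 0).map_zero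
  obtain ⟨w₁, hw₁0, hw₁⟩ := Family.exists_root hf (V := fun _ _ => 0) (M := fun _ => 1) (z₀ := κ)
    (Eventually.of_forall fun s => contDiffAt_const)
    (Eventually.of_forall fun s => contDiffAt_const)
    (by
      rw [show (fun _ : Fin k => (0 : ℝ)) = 0 from rfl, hzero]
      linear_combination κ / 2 * hκ1)
    (by
      rw [hκ1]
      intro h
      exact hXL (by linarith))
  set A : Finset (Fin k) := Finset.univ.filter fun i => L.σ i d' = a' with hA
  set fA : ℝ := f.inputDeriv (fun i => if i ∈ A then 1 else 0) with hfA
  have hfA0 : fA ≠ 0 := hnd.inputDeriv_ne A ⟨i₀, by simp [hA, hi₀]⟩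
  -- The side of `l = 0` on which the fold equation of the cell `d'` has real roots.
  obtain ⟨e, he, hsign⟩ : ∃ e : ℝ, (e = 1 ∨ e = -1) ∧ f.coeffXX * (e * κ * fA) < 0 := by
    rcases lt_or_gt_of_ne (mul_ne_zero hXX (mul_ne_zero hκ0 hfA0)) with h | h
    · exact ⟨1, Or.inl rfl, by simpa using h⟩
    · exact ⟨-1, Or.inr rfl, by linarith⟩
  obtain ⟨z₀, hz₀, hz₀'⟩ := exists_sqrt_with_sign hsign (hnd.inputDeriv_one_ne i₀)
  have hz₀ne : z₀ ≠ 0 := by rintro rfl; simp at hz₀'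
  have hw₁e := (tendsto_mul_sq e).eventually hw₁
  have hsm₁ : ∀ᶠ s in 𝓝 (0 : ℝ), ContDiffAt ℝ ∞ (fun s => w₁ (e * s ^ 2)) s := by
    filter_upwards [hw₁e] with s hs
    exact hs.1.comp s (f := fun s => e * s ^ 2) (by fun_prop)
  -- Here `l = e s²`: the cell `a'` has value `e s² w₁(e s²)`, of weight 2, and `l = s * (e s)`.
  obtain ⟨w, hw0, hw⟩ := Family.exists_root hf
    (V := fun s i => if L.σ i d' = a' then e * w₁ (e * s ^ 2) else 0)
    (M := fun s => e * s) (z₀ := z₀)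
    (by
      filter_upwards [hsm₁] with s hs
      refine contDiffAt_pi.2 fun i => ?_
      by_cases hi : L.σ i d' = a'
      · simp only [hi, if_true]
        exact contDiffAt_const.mul hs
      · simp only [hi, if_false]
        exact contDiffAt_const)
    (Eventually.of_forall fun s => by fun_prop)
    (by
      have : (fun i : Fin k => if L.σ i d' = a' then e * w₁ (e * (0 : ℝ) ^ 2) else 0) =
          (e * κ) • fun i => if i ∈ A then (1 : ℝ) else 0 := by
        funext i
        simp [hA, hw₁0]
      rw [this, Family.inputDeriv_smul, ← hfA]
      linear_combination hz₀)
    (by simpa using ⟨hXX, hz₀ne⟩)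
  have had : a' ≠ d' := by rintro rfl; omega
  have hB : ∀ c, layer c < j → c ≠ a' ∧ c ≠ d' := fun c hc =>
    ⟨by rintro rfl; omega, by rintro rfl; omega⟩
  refine ⟨e, he, fun s c => if c = a' then e * s ^ 2 * w₁ (e * s ^ 2) else
    if c = d' then s * w s else 0, w, fun c => ?_, fun c hc => ?_, fun c hc t => ?_, ?_, ?_,
    fun c => ?_, fun t => ?_, ?_⟩
  · by_cases h1 : c = a'
    · simp only [h1, if_true]
      filter_upwards [hsm₁] with s hs
      exact ContDiffAt.mul (by fun_prop) hs
    · by_cases h2 : c = d'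
      · simp only [h2, had.symm, if_true, if_false]
        filter_upwards [hw] with s hs
        exact contDiffAt_id.mul hs.1
      · simp only [h1, h2, if_false]
        exact Eventually.of_forall fun s => contDiffAt_const
  · by_cases h1 : c = a'
    · subst h1
      filter_upwards [hw₁e] with s hs
      -- As `0 < j`, the inputs of `a'` lie in layer `j - 1` and are zero; in layer 0 the cell would
      -- be its own input.
      have hin : ∀ i, L.σ i c ≠ c ∧ L.σ i c ≠ d' := fun i =>
        hB _ (by rw [hL.next_layer c (j - 1) (by omega)]; omega)
      simp only [if_true, (hin _).1, (hin _).2, if_false]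
      refine Eq.trans (congrArg f.toFun ?_) hs.2
      refine Prod.ext rfl (Prod.ext ?_ ?_)
      · funext i
        simp
      · simp
    · by_cases h2 : c = d'
      · subst h2
        filter_upwards [hw] with s hs
        have hin : ∀ i, L.σ i c ≠ c := fun i hi => by
          have := hL.next_layer c j hd i
          rw [hi] at this
          omega
        simp only [h1, if_true, hin, if_false]
        refine Eq.trans (congrArg f.toFun ?_) hs.2
        refine Prod.ext rfl (Prod.ext ?_ ?_)
        · funext i
          simp only [Pi.smul_apply, smul_eq_mul, mul_ite, mul_zero]
          congr 1
          ring
        · simp only [pow_one]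
          ring
      · refine Eventually.of_forall fun s => ?_
        have hlt : layer c ≠ j + 1 := fun h => h2 (hd' c h)
        have hin : ∀ i, L.σ i c ≠ a' ∧ L.σ i c ≠ d' := fun i => by
          rcases ht : layer c with _ | t
          · rw [hL.first_layer c ht]
            exact ⟨h1, h2⟩
          · exact hB _ (by rw [hL.next_layer c t ht]; omega)
        simp only [h1, h2, (hin _).1, (hin _).2, if_false]
        exact f.map_zero _
  · rw [hd' c hc]
    simp [had.symm]
  · filter_upwards [hw] with s hs using hs.1
  · rwa [hw0]
  · simp
  · have : a ≠ d' := by rintro rfl; omega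
    simp [haa, this]
  · have h1 : ∀ᶠ s in 𝓝 (0 : ℝ), w₁ (e * s ^ 2) ≠ 0 :=
      (tendsto_mul_sq e).eventually
        (hw₁.self_of_nhds.1.continuousAt.eventually_ne (by rwa [hw₁0]))
    have he0 : e ≠ 0 := by rcases he with rfl | rfl <;> norm_num
    filter_upwards [nhdsWithin_le_nhds h1, self_mem_nhdsWithin] with s hs hs0
    simpa using ⟨⟨he0, hs0⟩, hs⟩

theorem exists_isPartialBranch {L : Network k C'} {f : Family k} (hf : f ∈ V0 k)
    (hnd : f.Nondegenerate) {m j : ℕ} {layer : C' → ℕ} (hL : IsFeedForward L m layer)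
    (hj : 0 < j) (hjm : j < m) {d a a' : C'} (hd : layer d = j + 1)
    (hd' : ∀ c, layer c = j + 1 → c = d) (haa : a ≠ a') (ha : layer a = j) (ha' : layer a' = j) :
    ∃ e : ℝ, (e = 1 ∨ e = -1) ∧ ∃ p B w, IsPartialBranch L f layer a a' e m p B w := by
  obtain ⟨e, he, hbase⟩ := exists_isPartialBranch_base hf hnd hL hj hjm hd hd' haa ha ha'
  obtain ⟨-, i₀, -, -⟩ := hL.source a (by omega)
  refine ⟨e, he, ?_⟩
  have key : ∀ q, ∃ p B w, IsPartialBranch L f layer a a' e (j + 1 + q) p B w := by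
    intro q
    induction q with
    | zero => exact ⟨1, hbase⟩
    | succ q ih =>
      obtain ⟨p, B, w, h⟩ := ih
      exact ⟨p + 1, h.step hf hnd hL i₀ (show layer a ≤ j + 1 + q by omega)
        (show layer a' ≤ j + 1 + q by omega)⟩
  obtain ⟨q, rfl⟩ := Nat.exists_eq_add_of_le (show j + 1 ≤ m from hjm)
  exact key q

/-- Substituting `t = |l|^(1/2^p)` on the side of sign `e` turns the parametrized solution into a
branch; finiteness of the set of cells gives a common radius. -/
theorem IsPartialBranch.exists_branch [Finite C'] {L : Network k C'} {f : Family k} {m : ℕ}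
    {layer : C' → ℕ} (hL : IsFeedForward L m layer) {a a' : C'} {e : ℝ} (he : e = 1 ∨ e = -1)
    {p : ℕ} {B : ℝ → C' → ℝ} {w : ℝ → ℝ} (h : IsPartialBranch L f layer a a' e m p B w) :
    ∃ D b, IsEquilibriumBranch L f D b ∧ ¬ ∀ᶠ l in 𝓝[D] 0, b l a = b l a' := by
  have hall : ∀ᶠ t in 𝓝 (0 : ℝ), ∀ c, ContDiffAt ℝ ∞ (fun t => B t c) t ∧
      f.toFun (B t c, fun i => B t (L.σ i c), e * t ^ (2 ^ p)) = 0 :=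
    eventually_all.2 fun c => (h.smooth c).and (h.equilibrium c (hL.layer_le c))
  obtain ⟨δ, hδ, hball⟩ := Metric.eventually_nhds_iff.1 hall
  have hP : 2 ^ p ≠ 0 := by positivity
  set r : ℝ := δ ^ (2 ^ p) with hr
  have hr0 : 0 < r := pow_pos hδ _
  have hlt : ∀ t : ℝ, 0 ≤ t → t ^ (2 ^ p) < r → dist t 0 < δ := by
    intro t ht htr
    rw [Real.dist_0_eq_abs, abs_of_nonneg ht]
    exact lt_of_pow_lt_pow_left₀ _ hδ.le htr
  have hee : e * e = 1 := by rcases he with rfl | rfl <;> norm_num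
  have habs : ∀ t : ℝ, 0 ≤ t → |e * t ^ (2 ^ p)| = t ^ (2 ^ p) := by
    intro t ht
    rw [abs_mul, abs_of_nonneg (pow_nonneg ht _)]
    rcases he with rfl | rfl <;> simp
  set b : ℝ → C' → ℝ := fun l => B (|l| ^ (((2 ^ p : ℕ) : ℝ)⁻¹)) with hb
  have hbt : ∀ t : ℝ, 0 ≤ t → b (e * t ^ (2 ^ p)) = B t := by
    intro t ht
    rw [hb]
    simp only
    rw [habs t ht, Real.pow_rpow_inv_natCast ht hP]
  have hroot : RootSmooth e r b := by
    refine ⟨p, fun c => ?_⟩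
    refine ContDiffOn.congr (f := fun t => B t c) (fun t ht => ?_) fun t ht => ?_
    · exact (hball (hlt t ht.1 ht.2) c).1.contDiffWithinAt
    · rw [hbt t ht.1]
  obtain ⟨D, hreg, hmem, hmem'⟩ : ∃ D, RegularOn D b ∧ (∀ l ∈ D, e * |l| = l ∧ |l| < r) ∧
      ∀ t : ℝ, 0 ≤ t → t < r → e * t ∈ D := by
    rcases he with rfl | rfl
    · refine ⟨Ico 0 r, ⟨r, hr0, Or.inr (Or.inl ⟨rfl, hroot⟩)⟩, fun l hl => ?_, fun t h1 h2 => ?_⟩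
      · rw [abs_of_nonneg hl.1, one_mul]
        exact ⟨rfl, hl.2⟩
      · rw [one_mul]
        exact ⟨h1, h2⟩
    · refine ⟨Ioc (-r) 0, ⟨r, hr0, Or.inr (Or.inr ⟨rfl, hroot⟩)⟩, fun l hl => ?_,
        fun t h1 h2 => ?_⟩
      · rw [abs_of_nonpos hl.2]
        exact ⟨by ring, by linarith [hl.1]⟩
      · exact ⟨by linarith, by linarith⟩
  refine ⟨D, b, ⟨hreg, ?_, fun l hl => ?_⟩, fun hev => ?_⟩
  · have := hbt 0 le_rfl
    rw [zero_pow hP, mul_zero] at this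
    rw [this]
    exact funext h.origin
  · obtain ⟨h1, h2⟩ := hmem l hl
    set t : ℝ := |l| ^ (((2 ^ p : ℕ) : ℝ)⁻¹) with ht
    have ht0 : 0 ≤ t := Real.rpow_nonneg (abs_nonneg l) _
    have htp : t ^ (2 ^ p) = |l| := Real.rpow_inv_natCast_pow (abs_nonneg l) hP
    funext c
    have := (hball (hlt t ht0 (by rwa [htp])) c).2
    rw [htp, h1] at this
    exact this
  · have htend : Tendsto (fun t : ℝ => e * t ^ (2 ^ p)) (𝓝[>] 0) (𝓝[D] 0) := by
      refine tendsto_nhdsWithin_iff.2 ⟨?_, ?_⟩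
      · exact (Continuous.tendsto' (by fun_prop) _ _ (by simp)).mono_left nhdsWithin_le_nhds
      · filter_upwards [self_mem_nhdsWithin, nhdsWithin_le_nhds (Iio_mem_nhds hδ)] with t h1 h2
        exact hmem' _ (pow_nonneg (le_of_lt h1) _) (pow_lt_pow_left₀ h2 (le_of_lt h1) hP)
    have hne : ∀ᶠ t in 𝓝[>] (0 : ℝ), B t a' ≠ 0 :=
      h.ne_zero.filter_mono (nhdsWithin_mono _ fun t ht => ne_of_gt ht)
    obtain ⟨t, h1, h2, h3⟩ :=
      ((htend.eventually hev).and (hne.and self_mem_nhdsWithin)).exists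
    rw [hbt t (le_of_lt h3), h.eq_zero] at h1
    exact h2 h1.symm

end FFN

/-! ### The proposition -/

theorem mainTheorem9 (k : ℕ) :
    FFN.GenericInV0 k (fun f =>
      ∀ (C : Type*) (C' : Type*) [Finite C] [Finite C']
        (N : FFN.Network k C) (m : ℕ) (layer : C → ℕ)
        (L : FFN.Network k C') (n : ℕ) (layer' : C' → ℕ) (j : ℕ),
        FFN.IsFeedForward N m layer →
        FFN.IsFeedForward L n layer' →
        FFN.IsLiftInsideLayer N m layer L n layer' j →
        0 < j → j < m → FFN.layerCard layer (j + 1) = 1 →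
        ∃ (D : Set ℝ) (b : ℝ → C' → ℝ),
          FFN.IsBifurcationBranch L f D b ∧ ¬ FFN.IsLiftedFrom L N D b) := by
  refine ⟨_, FFN.isOpen_nondegenerate, FFN.dense_nondegenerate, fun f hf => ?_⟩
  intro C C' _ _ N m layer L n layer' j hN hL h hj hjm hcard
  obtain rfl := h.same_length
  obtain ⟨d, hd, hd', a, a', haa, ha, ha', hpair⟩ :=
    FFN.exists_pair_of_isLiftInsideLayer hN hL h hjm hcard
  obtain ⟨e, he, p, B, w, hB⟩ :=
    FFN.exists_isPartialBranch f.2 hf hL hj hjm hd hd' haa ha ha'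
  obtain ⟨D, b, hb, hne⟩ := hB.exists_branch hL he
  -- A zero germ and a lifted germ would both have equal components at `a` and `a'`.
  refine ⟨D, b, ⟨hb, fun h0 => hne ?_⟩, ?_⟩
  · filter_upwards [h0] with l hl
    rw [hl]
    rfl
  · rintro ⟨s, hs, hev, hsame⟩
    refine hne ?_
    filter_upwards [hev] with l hl
    exact hl a a' (hpair s hs hsame)
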